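/- There is an absolute constant $c>0$ such that the following holds for every finite set $A\subset\mathbb{R}$ with $|A|\ge 2$. Let $P=A\times A\subset\mathbb{R}^2$, let $B(P)$ be the set of all perpendicular bisectors of pairs of distinct points of $P$, and let $\ell=\{(0,t):t\in\mathbb{R}\}$ be the $y$-axis. Then the bisectors in $B(P)$ other than $\ell$ itself meet $\ell$ in at least $c\,|A|^2$ distinct points, that is, $$\bigl|\{z\in\ell : z\in L \text{ for some } L\in B(P),\ L\neq \ell\}\bigr|\ \ge\ c\,|A|^2 .$$ -/

import Mathlib

/-- The Euclidean plane. -/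
abbrev Plane : Type := EuclideanSpace ℝ (Fin 2)

/-- The Cartesian square `A × A`, as a set of points of the Euclidean plane. -/
def gridPoints (A : Finset ℝ) : Set Plane :=
  {p | p 0 ∈ A ∧ p 1 ∈ A}

/-- The set of all perpendicular bisectors determined by pairs of distinct points of `P`. -/
def bisectors (P : Set Plane) : Set (AffineSubspace ℝ Plane) :=
  {L | ∃ p ∈ P, ∃ q ∈ P, p ≠ q ∧ L = AffineSubspace.perpBisector p q}

/-- The `y`-axis. -/
def yAxis : Set Plane :=
  {z | z 0 = 0}

/-- The points in which the lines of a family `B` that are different from the line `l` meet `l`.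
(If `l` itself belongs to `B`, it contributes no points.) -/
def hittingPoints (B : Set (AffineSubspace ℝ Plane)) (l : Set Plane) : Set Plane :=
  {z | z ∈ l ∧ ∃ L ∈ B, (L : Set Plane) ≠ l ∧ z ∈ L}

/-!
The point `(0, t)` is equidistant from `(a, b)` and `(c, d)` exactly if
`c ^ 2 + d ^ 2 - (a ^ 2 + b ^ 2) = 2 * t * (d - b)`. For `b ≠ d` this says that `2 * t` is the slope
of the line through `(b, a ^ 2 + b ^ 2)` and `(d, c ^ 2 + d ^ 2)`; for `b = d` the bisector either is
the axis or misses it. So the hitting points correspond to the non-vertical slopes determined by the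
set `liftedGrid A` of all `(b, a ^ 2 + b ^ 2)`, which has at least `|A| ^ 2 / 2` points on `|A|`
vertical lines. That such a set determines a quadratic number of slopes is a weak form of Ungar's
theorem on directions, `two_mul_card_le_card_slopes`.

Ungar's argument lists the points by the intercept of the line of slope `θ` through them and lets `θ`
grow. The list changes only when `θ` passes a slope of the set; there, each block of points on a
common line of slope `θ` is reversed, from increasing to decreasing first coordinate
(`lexRank_intercept_eq`). Fix a cut between two positions of the list and consider the longest
monotone run around it, measured by the potential of `CutPotentialLE`, which is positive for
increasing runs and negative for decreasing ones. A slope without a block across the cut raises the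
potential by at most one (`CutPotentialLE.reverse_blocks`). A slope at which `d` points pass the cut
in each direction makes an increasing run of `d` points on each side decreasing, so it lowers the
potential by at least `2 * d - 1` (`CutPotentialLE.reverse_crossing_block`). The points of the left
half of the set all have to pass the cut during the rotation, and the potential is bounded in
absolute value by the number of vertical lines, since a monotone run has distinct first coordinates.
Hence the number of slopes is at least twice the number of points of the left half, up to an error
linear in the number of vertical lines.
-/

/-! ### Lists ordered by a function with ties, and block reversals -/

section LexRank

variable {α : Type*} {Q : Finset α} {f x : α → ℝ} {h : ℕ}

/-- The position of `q` when `Q` is listed by increasing `f`, ties being broken by increasing `x`;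
positions are counted from `0`. -/
noncomputable def lexRank (Q : Finset α) (f x : α → ℝ) (q : α) : ℕ :=
  (Q.filter fun p => f p < f q ∨ f p = f q ∧ x p < x q).card

/-- The first position of the block of points with `f = v`. -/
noncomputable def blockStart (Q : Finset α) (f : α → ℝ) (v : ℝ) : ℕ :=
  (Q.filter fun p => f p < v).card

/-- The position just after the block of points with `f = v`. -/
noncomputable def blockEnd (Q : Finset α) (f : α → ℝ) (v : ℝ) : ℕ :=
  (Q.filter fun p => f p ≤ v).card

/-- `f` and `x` together separate the points of `Q`, so that `lexRank Q f x` is a linear order. -/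
def SeparatesPoints (Q : Finset α) (f x : α → ℝ) : Prop :=
  ∀ p ∈ Q, ∀ q ∈ Q, f p = f q → x p = x q → p = q

theorem SeparatesPoints.neg (hs : SeparatesPoints Q f x) : SeparatesPoints Q f (-x) :=
  fun p hp q hq h1 h2 => hs p hp q hq h1 (neg_injective h2)

theorem lexRank_lt_of_lex {p q : α} (hp : p ∈ Q) (hpq : f p < f q ∨ f p = f q ∧ x p < x q) :
    lexRank Q f x p < lexRank Q f x q := by
  unfold lexRank
  apply Finset.card_lt_card
  rw [Finset.ssubset_iff_of_subset]
  · exact ⟨p, by simp [hp, hpq], by simp⟩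
  · intro z
    simp only [Finset.mem_filter]
    rintro ⟨hz, hzp⟩
    refine ⟨hz, ?_⟩
    grind

theorem lexRank_lt_iff (hs : SeparatesPoints Q f x) {p q : α} (hp : p ∈ Q) (hq : q ∈ Q) :
    lexRank Q f x p < lexRank Q f x q ↔ f p < f q ∨ f p = f q ∧ x p < x q := by
  refine ⟨fun hlt => ?_, lexRank_lt_of_lex hp⟩
  by_contra hn
  have hqp : p = q ∨ (f q < f p ∨ f q = f p ∧ x q < x p) := by
    have := hs p hp q hq
    grind
  rcases hqp with rfl | hqp
  · exact lt_irrefl _ hlt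
  · exact lt_asymm hlt (lexRank_lt_of_lex hq hqp)

theorem lexRank_injOn (hs : SeparatesPoints Q f x) : Set.InjOn (lexRank Q f x) Q := by
  intro p hp q hq hpq
  have h1 := lexRank_lt_iff hs hp hq
  have h2 := lexRank_lt_iff hs hq hp
  have := hs p hp q hq
  grind

theorem lexRank_lt_card {q : α} (hq : q ∈ Q) : lexRank Q f x q < Q.card := by
  apply Finset.card_lt_card
  rw [Finset.filter_ssubset]
  exact ⟨q, hq, by simp⟩

theorem exists_lexRank_eq (hs : SeparatesPoints Q f x) {k : ℕ} (hk : k < Q.card) :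
    ∃ q ∈ Q, lexRank Q f x q = k := by
  have himg : Q.image (lexRank Q f x) = Finset.range Q.card := by
    apply Finset.eq_of_subset_of_card_le
    · intro i hi
      obtain ⟨q, hq, rfl⟩ := Finset.mem_image.1 hi
      exact Finset.mem_range.2 (lexRank_lt_card hq)
    · rw [Finset.card_image_of_injOn (lexRank_injOn hs), Finset.card_range]
  have : k ∈ Q.image (lexRank Q f x) := by rw [himg]; exact Finset.mem_range.2 hk
  simpa using this

theorem blockStart_le_lexRank (q : α) : blockStart Q f (f q) ≤ lexRank Q f x q := by
  apply Finset.card_le_card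
  intro p
  simp only [Finset.mem_filter]
  tauto

theorem lexRank_lt_blockEnd {q : α} (hq : q ∈ Q) : lexRank Q f x q < blockEnd Q f (f q) := by
  apply Finset.card_lt_card
  rw [Finset.ssubset_iff_of_subset]
  · exact ⟨q, by simp [hq], by simp⟩
  · intro p
    simp only [Finset.mem_filter]
    grind

theorem blockEnd_le_card (v : ℝ) : blockEnd Q f v ≤ Q.card := Finset.card_filter_le _ _

theorem le_of_blockStart_le_lexRank {q : α} (hq : q ∈ Q) {v : ℝ}
    (hv : blockStart Q f v ≤ lexRank Q f x q) : v ≤ f q := by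
  by_contra! hlt
  refine hv.not_gt (Finset.card_lt_card ?_)
  rw [Finset.ssubset_iff_of_subset]
  · exact ⟨q, by simp [hq, hlt], by simp⟩
  · intro p
    simp only [Finset.mem_filter]
    grind

theorem le_of_lexRank_lt_blockEnd {q : α} {v : ℝ}
    (hv : lexRank Q f x q < blockEnd Q f v) : f q ≤ v := by
  by_contra! hlt
  refine hv.not_ge (Finset.card_le_card ?_)
  intro p
  simp only [Finset.mem_filter]
  grind

/-- Reversing the tie-breaking reflects the position of a point inside its block. -/
theorem lexRank_add_lexRank_neg (hs : SeparatesPoints Q f x) {q : α} (hq : q ∈ Q) :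
    lexRank Q f x q + lexRank Q f (-x) q + 1
      = blockStart Q f (f q) + blockEnd Q f (f q) := by
  have := Classical.decEq α
  set U := Q.filter fun p => f p < f q ∨ f p = f q ∧ x p < x q with hU
  set V := Q.filter fun p => f p < f q ∨ f p = f q ∧ (-x) p < (-x) q with hV
  have hinter : U ∩ V = Q.filter fun p => f p < f q := by
    ext p
    simp only [hU, hV, Finset.mem_inter, Finset.mem_filter, Pi.neg_apply]
    grind
  have hnot : q ∉ U ∪ V := by simp [hU, hV]
  have hunion : insert q (U ∪ V) = Q.filter fun p => f p ≤ f q := by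
    ext p
    have := hs p
    simp only [hU, hV, Finset.mem_insert, Finset.mem_union, Finset.mem_filter, Pi.neg_apply]
    grind
  have hcard := Finset.card_union_add_card_inter U V
  have hcard' := Finset.card_insert_of_notMem hnot
  rw [hunion] at hcard'
  rw [hinter] at hcard
  change U.card + V.card + 1 =
    (Q.filter fun p => f p < f q).card + (Q.filter fun p => f p ≤ f q).card
  omega

/-! ### Monotone runs around a cut -/

/-- The points at positions `h - r, …, h + r - 1` have strictly increasing `x`. Positions that do
not occur impose no condition. -/
def IncreasingRun (Q : Finset α) (ρ : α → ℕ) (x : α → ℝ) (h r : ℕ) : Prop :=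
  ∀ p ∈ Q, ∀ q ∈ Q, h ≤ ρ p + r → ρ p < ρ q → ρ q < h + r → x p < x q

/-- If no block straddles the cut at `h`, reversing all blocks shortens a decreasing run around the
cut by at most one on each side: a block, being increasing, shares at most one point with the run,
so a block that reaches past the end of the run is a single point. -/
theorem IncreasingRun.reverse_blocks (hs : SeparatesPoints Q f x)
    (hno : ∀ v, ¬ (blockStart Q f v < h ∧ h < blockEnd Q f v)) {r : ℕ}
    (hrun : IncreasingRun Q (lexRank Q f x) (-x) h (r + 1)) :
    IncreasingRun Q (lexRank Q f (-x)) (-x) h r := by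
  have key : ∀ q ∈ Q, h ≤ lexRank Q f (-x) q + r → lexRank Q f (-x) q < h + r →
      lexRank Q f x q = lexRank Q f (-x) q := by
    intro q hq h1 h2
    have a1 := blockStart_le_lexRank (Q := Q) (f := f) (x := x) q
    have a2 := lexRank_lt_blockEnd (f := f) (x := x) hq
    have b1 := blockStart_le_lexRank (Q := Q) (f := f) (x := -x) q
    have b2 := lexRank_lt_blockEnd (f := f) (x := -x) hq
    have hc := blockEnd_le_card (Q := Q) (f := f) (f q)
    have hclash : ∀ s, blockStart Q f (f q) ≤ s → s + 1 < blockEnd Q f (f q) →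
        h ≤ s + (r + 1) → s < h + r → False := by
      intro s s1 s2 s3 s4
      obtain ⟨p₁, hp₁, e₁⟩ := exists_lexRank_eq hs (k := s) (by omega)
      obtain ⟨p₂, hp₂, e₂⟩ := exists_lexRank_eq hs (k := s + 1) (by omega)
      have c1 := le_of_blockStart_le_lexRank hp₁ (e₁ ▸ s1)
      have c2 : f p₂ ≤ f q := le_of_lexRank_lt_blockEnd (e₂ ▸ s2)
      have c3 := (lexRank_lt_iff hs hp₁ hp₂).1 (by omega)
      have c4 := hrun p₁ hp₁ p₂ hp₂ (by omega) (by omega) (by omega)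
      simp only [Pi.neg_apply] at c4
      rcases c3 with c3 | c3 <;> linarith
    rcases le_or_gt h (blockStart Q f (f q)) with hle | hlt
    · by_contra hne
      exact hclash (blockStart Q f (f q)) le_rfl (by omega) (by omega) (by omega)
    · have hle : blockEnd Q f (f q) ≤ h := by
        by_contra hgt
        exact hno (f q) ⟨hlt, by omega⟩
      by_contra hne
      exact hclash (blockEnd Q f (f q) - 2) (by omega) (by omega) (by omega) (by omega)
  intro p hp q hq h1 h2 h3
  have e1 := key p hp h1 (by omega)
  have e2 := key q hq (by omega) h3
  exact hrun p hp q hq (by omega) (by omega) (by omega)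

/-- `E` bounds from above the potential of the cut at `h`. The potential is `r` if the longest
increasing run around the cut has `r ≥ 1` points on each side, it is `1 - r` if the longest
decreasing run has `r ≥ 1` points on each side, and it is `0` if there is neither. -/
def CutPotentialLE (Q : Finset α) (ρ : α → ℕ) (x : α → ℝ) (h : ℕ) (E : ℤ) : Prop :=
  (0 ≤ E ∧ ∀ r : ℕ, IncreasingRun Q ρ x h r → (r : ℤ) ≤ E) ∨
    ∃ k : ℕ, IncreasingRun Q ρ (-x) h (k + 1) ∧ -(k : ℤ) ≤ E

theorem CutPotentialLE.mono {ρ : α → ℕ} {E E' : ℤ} (hE : CutPotentialLE Q ρ x h E)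
    (hle : E ≤ E') : CutPotentialLE Q ρ x h E' := by
  rcases hE with ⟨h0, hr⟩ | ⟨k, hk, hkE⟩
  · exact Or.inl ⟨by omega, fun r hrun => (hr r hrun).trans hle⟩
  · exact Or.inr ⟨k, hk, by omega⟩

theorem IncreasingRun.eq_zero_of_neg (hs : SeparatesPoints Q f x) (h0 : 0 < h) (hN : h < Q.card)
    {r k : ℕ} (hr : IncreasingRun Q (lexRank Q f x) x h r)
    (hk : IncreasingRun Q (lexRank Q f x) (-x) h (k + 1)) : r = 0 := by
  by_contra hne
  obtain ⟨p₁, hp₁, e₁⟩ := exists_lexRank_eq hs (k := h - 1) (by omega)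
  obtain ⟨p₂, hp₂, e₂⟩ := exists_lexRank_eq hs hN
  have c1 := hr p₁ hp₁ p₂ hp₂ (by omega) (by omega) (by omega)
  have c2 := hk p₁ hp₁ p₂ hp₂ (by omega) (by omega) (by omega)
  simp only [Pi.neg_apply] at c2
  linarith

/-- A block reversal that does not affect the cut raises the potential by at most one. -/
theorem CutPotentialLE.reverse_blocks (hs : SeparatesPoints Q f x) (h0 : 0 < h)
    (hN : h < Q.card) (hno : ∀ v, ¬ (blockStart Q f v < h ∧ h < blockEnd Q f v)) {E : ℤ}
    (hE : CutPotentialLE Q (lexRank Q f x) x h E) :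
    CutPotentialLE Q (lexRank Q f (-x)) x h (E + 1) := by
  have hinc : ∀ r, IncreasingRun Q (lexRank Q f (-x)) x h (r + 1) →
      IncreasingRun Q (lexRank Q f x) x h r := by
    intro r hr
    simpa using IncreasingRun.reverse_blocks hs.neg hno (by simpa using hr)
  rcases hE with ⟨hE0, hr⟩ | ⟨k, hk, hkE⟩
  · refine Or.inl ⟨by omega, fun r hrun => ?_⟩
    cases r with
    | zero => push_cast; omega
    | succ r => have := hr r (hinc r hrun); push_cast; omega
  · cases k with
    | zero =>
      refine Or.inl ⟨by simp at hkE; omega, fun r hrun => ?_⟩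
      cases r with
      | zero => push_cast at *; omega
      | succ r =>
        have := IncreasingRun.eq_zero_of_neg hs h0 hN (hinc r hrun) hk
        push_cast at *; omega
    | succ k => exact Or.inr ⟨k, IncreasingRun.reverse_blocks hs hno hk, by push_cast at *; omega⟩

/-- A block that reaches at least `d ≥ 1` points to each side of the cut turns an increasing run
into a decreasing one, which lowers the potential by at least `2 * d - 1`. -/
theorem CutPotentialLE.reverse_crossing_block (hs : SeparatesPoints Q f x) (h0 : 0 < h)
    (hN : h < Q.card) {v : ℝ} {d : ℕ} (hd : 1 ≤ d) (hlo : blockStart Q f v + d ≤ h)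
    (hhi : h + d ≤ blockEnd Q f v) {E : ℤ} (hE : CutPotentialLE Q (lexRank Q f x) x h E) :
    CutPotentialLE Q (lexRank Q f (-x)) x h (E + 1 - 2 * d) := by
  have hrun : ∀ y : α → ℝ, SeparatesPoints Q f y →
      IncreasingRun Q (lexRank Q f y) y h d := by
    intro y hy p hp q hq h1 h2 h3
    have c1 : v ≤ f p := le_of_blockStart_le_lexRank (x := y) hp (by omega)
    have c2 : f q ≤ v := le_of_lexRank_lt_blockEnd (Q := Q) (x := y) (by omega)
    rcases (lexRank_lt_iff hy hp hq).1 h2 with c3 | c3 <;> grind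
  have hdE : (d : ℤ) ≤ E := by
    rcases hE with ⟨-, hr⟩ | ⟨k, hk, -⟩
    · exact hr d (hrun x hs)
    · have := IncreasingRun.eq_zero_of_neg hs h0 hN (hrun x hs) hk
      omega
  refine Or.inr ⟨d - 1, ?_, by omega⟩
  rw [Nat.sub_add_cancel hd]
  exact hrun (-x) hs.neg

/-- The number of points of `L` at positions below the cut at `h`. -/
def countBelow (L : Finset α) (ρ : α → ℕ) (h : ℕ) : ℕ := (L.filter fun q => ρ q < h).card

/-- Reversing the blocks raises the potential by at most one, less twice the number of points that
move across the cut. -/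
theorem CutPotentialLE.step (hs : SeparatesPoints Q f x) (h0 : 0 < h)
    (hN : h < Q.card) {L : Finset α} (hL : L ⊆ Q) {E : ℤ}
    (hE : CutPotentialLE Q (lexRank Q f x) x h E) :
    CutPotentialLE Q (lexRank Q f (-x)) x h
      (E + 1 - 2 * ((countBelow L (lexRank Q f x) h : ℤ)
        - countBelow L (lexRank Q f (-x)) h)) := by
  have := Classical.decEq α
  by_cases hno : ∀ v, ¬ (blockStart Q f v < h ∧ h < blockEnd Q f v)
  · have heq : countBelow L (lexRank Q f x) h = countBelow L (lexRank Q f (-x)) h := by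
      unfold countBelow
      congr 1
      apply Finset.filter_congr
      intro q hq
      have a1 := blockStart_le_lexRank (Q := Q) (f := f) (x := x) q
      have a2 := lexRank_lt_blockEnd (f := f) (x := x) (hL hq)
      have b1 := blockStart_le_lexRank (Q := Q) (f := f) (x := -x) q
      have b2 := lexRank_lt_blockEnd (f := f) (x := -x) (hL hq)
      have := hno (f q)
      omega
    exact (hE.reverse_blocks hs h0 hN hno).mono (by omega)
  · push Not at hno
    obtain ⟨v, hlo, hhi⟩ := hno
    set l := blockStart Q f v with hl
    set u := blockEnd Q f v with hu
    have hcount : countBelow L (lexRank Q f x) h ≤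
        countBelow L (lexRank Q f (-x)) h + min (h - l) (u - h) := by
      set X := L.filter fun q => lexRank Q f x q < h with hX
      set Y := L.filter fun q => lexRank Q f (-x) q < h with hY
      have hdiff : (X \ Y).card ≤ (Finset.Ico l (l + min (h - l) (u - h))).card := by
        apply Finset.card_le_card_of_injOn (lexRank Q f x)
        · intro q hq
          simp only [hX, hY, Finset.coe_sdiff, Finset.coe_filter, Set.mem_sdiff,
            Set.mem_ofPred_eq] at hq
          obtain ⟨⟨hqL, hq1⟩, hq2⟩ := hq
          have hqQ := hL hqL
          have hq3 : h ≤ lexRank Q f (-x) q := by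
            by_contra hlt
            exact hq2 ⟨hqL, by omega⟩
          -- The block of `q` straddles the cut, so it is the block with value `v`.
          have a1 := blockStart_le_lexRank (Q := Q) (f := f) (x := x) q
          have b2 := lexRank_lt_blockEnd (f := f) (x := -x) hqQ
          have c1 : v ≤ f q := le_of_blockStart_le_lexRank (x := -x) hqQ (by omega)
          have c2 : f q ≤ v := le_of_lexRank_lt_blockEnd (Q := Q) (x := x) (by omega)
          have hv : f q = v := le_antisymm c2 c1
          have hsum := lexRank_add_lexRank_neg hs hqQ
          rw [hv] at hsum a1 b2
          simp only [Finset.coe_Ico, Set.mem_Ico]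
          omega
        · intro p hp q hq
          simp only [hX, Finset.coe_sdiff, Finset.coe_filter, Set.mem_sdiff,
            Set.mem_ofPred_eq] at hp hq
          exact lexRank_injOn hs (hL hp.1.1) (hL hq.1.1)
      rw [Nat.card_Ico] at hdiff
      have := Finset.card_le_card_sdiff_add_card (s := X) (t := Y)
      change X.card ≤ Y.card + _
      omega
    refine (hE.reverse_crossing_block hs h0 hN (v := v) (d := min (h - l) (u - h)) (by omega)
      (by omega) (by omega)).mono ?_
    omega

theorem IncreasingRun.le_card_image (hs : SeparatesPoints Q f x) (hN : h < Q.card)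
    {y : α → ℝ} (hn : (Q.image y).card < h) {r : ℕ}
    (hr : IncreasingRun Q (lexRank Q f x) y h r) : r ≤ (Q.image y).card := by
  have hcard : (Finset.Ico (h - r) h).card ≤ (Q.image y).card := by
    have hex : ∀ i, ∃ q, i ∈ Finset.Ico (h - r) h → q ∈ Q ∧ lexRank Q f x q = i := by
      intro i
      by_cases hi : i ∈ Finset.Ico (h - r) h
      · obtain ⟨q, hq, e⟩ := exists_lexRank_eq hs (k := i)
          (by have := Finset.mem_Ico.1 hi; omega)
        exact ⟨q, fun _ => ⟨hq, e⟩⟩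
      · obtain ⟨q, -, -⟩ := exists_lexRank_eq hs (k := 0) (by omega)
        exact ⟨q, fun hi' => absurd hi' hi⟩
    choose g hg using hex
    have hlt : ∀ i ∈ Finset.Ico (h - r) h, ∀ j ∈ Finset.Ico (h - r) h, i < j →
        y (g i) < y (g j) := by
      intro i hi j hj hij
      obtain ⟨hi1, hi2⟩ := hg i hi
      obtain ⟨hj1, hj2⟩ := hg j hj
      have := Finset.mem_Ico.1 hi
      have := Finset.mem_Ico.1 hj
      exact hr _ hi1 _ hj1 (by omega) (by omega) (by omega)
    apply Finset.card_le_card_of_injOn (fun i => y (g i))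
    · intro i hi
      exact Finset.mem_coe.2 (Finset.mem_image_of_mem _ (hg i hi).1)
    · intro i hi j hj hij
      by_contra hne
      rcases lt_or_gt_of_ne hne with hlt' | hlt'
      · exact (hlt i hi j hj hlt').ne hij
      · exact (hlt j hj i hi hlt').ne' hij
  rw [Nat.card_Ico] at hcard
  omega

end LexRank

theorem IncreasingRun.congr {α : Type*} {Q : Finset α} {ρ ρ' : α → ℕ} {x : α → ℝ} {h r : ℕ}
    (hρ : ∀ q ∈ Q, ρ q = ρ' q) : IncreasingRun Q ρ x h r ↔ IncreasingRun Q ρ' x h r := by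
  unfold IncreasingRun
  refine forall₂_congr fun p hp => forall₂_congr fun q hq => ?_
  rw [hρ p hp, hρ q hq]

theorem CutPotentialLE.congr {α : Type*} {Q : Finset α} {ρ ρ' : α → ℕ} {x : α → ℝ} {h : ℕ} {E : ℤ}
    (hρ : ∀ q ∈ Q, ρ q = ρ' q) : CutPotentialLE Q ρ x h E ↔ CutPotentialLE Q ρ' x h E := by
  simp only [CutPotentialLE, IncreasingRun.congr hρ]

/-! ### The number of slopes determined by a planar set -/

section Slopes

/-- The height at which the line of slope `θ` through `p` meets the axis `x = 0`. -/
def intercept (θ : ℝ) (p : ℝ × ℝ) : ℝ := p.2 - θ * p.1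

/-- The slope of the line through `p` and `q`; it is only used when `p.1 ≠ q.1`. -/
noncomputable def slopeOf (p q : ℝ × ℝ) : ℝ := (q.2 - p.2) / (q.1 - p.1)

variable {Q : Finset (ℝ × ℝ)} {T : Finset ℝ} {θ : ℝ}

theorem separatesPoints_intercept (Q : Finset (ℝ × ℝ)) (θ : ℝ) :
    SeparatesPoints Q (intercept θ) Prod.fst := by
  intro p _ q _ h1 h2
  unfold intercept at h1
  rw [h2] at h1
  exact Prod.ext h2 (by linarith)

theorem intercept_sub_intercept {p q : ℝ × ℝ} (hpq : p.1 < q.1) :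
    intercept θ q - intercept θ p = (slopeOf p q - θ) * (q.1 - p.1) := by
  have : q.1 - p.1 ≠ 0 := (sub_pos.2 hpq).ne'
  unfold intercept slopeOf
  field_simp
  ring

theorem intercept_lt_iff {p q : ℝ × ℝ} (hpq : p.1 < q.1) :
    intercept θ p < intercept θ q ↔ θ < slopeOf p q := by
  rw [← sub_pos, intercept_sub_intercept hpq, mul_pos_iff_of_pos_right (sub_pos.2 hpq), sub_pos]

theorem intercept_lt_iff' {p q : ℝ × ℝ} (hpq : p.1 < q.1) :
    intercept θ q < intercept θ p ↔ slopeOf p q < θ := by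
  have hd := sub_pos.2 hpq
  rw [← sub_neg, intercept_sub_intercept hpq, ← sub_neg (a := slopeOf p q)]
  exact ⟨fun hneg => by by_contra! h0; exact hneg.not_ge (mul_nonneg h0 hd.le),
    fun hneg => mul_neg_of_neg_of_pos hneg hd⟩

/-- If no slope lies strictly between `θ'` and `θ`, the order just after `θ'` is the order just
before `θ`. -/
theorem lexRank_intercept_eq
    (hT : ∀ p ∈ Q, ∀ q ∈ Q, p.1 < q.1 → slopeOf p q ∈ T) {θ' : ℝ} (hθ : θ' < θ)
    (hgap : ∀ σ ∈ T, σ < θ → σ ≤ θ') {q : ℝ × ℝ} (hq : q ∈ Q) :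
    lexRank Q (intercept θ') (-Prod.fst) q = lexRank Q (intercept θ) Prod.fst q := by
  unfold lexRank
  congr 1
  apply Finset.filter_congr
  intro p hp
  simp only [Pi.neg_apply, neg_lt_neg_iff]
  rcases lt_trichotomy p.1 q.1 with hlt | heq | hgt
  · have a1 := intercept_lt_iff (θ := θ) hlt
    have a2 := intercept_lt_iff' (θ := θ) hlt
    have b1 := intercept_lt_iff (θ := θ') hlt
    have := hgap _ (hT p hp q hq hlt)
    grind
  · have a : ∀ t, intercept t p < intercept t q ↔ p.2 < q.2 := by
      intro t
      unfold intercept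
      rw [heq]
      simp
    simp [a, heq]
  · have a1 := intercept_lt_iff (θ := θ) hgt
    have a2 := intercept_lt_iff' (θ := θ) hgt
    have b1 := intercept_lt_iff (θ := θ') hgt
    have b2 := intercept_lt_iff' (θ := θ') hgt
    have := hgap _ (hT q hq p hp hgt)
    grind

theorem countBelow_eq_card_of_le_slopes
    (hT : ∀ p ∈ Q, ∀ q ∈ Q, p.1 < q.1 → slopeOf p q ∈ T) (hθ : ∀ σ ∈ T, θ ≤ σ) (c : ℝ) :
    countBelow (Q.filter fun p => p.1 < c) (lexRank Q (intercept θ) Prod.fst)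
      (Q.filter fun p => p.1 < c).card = (Q.filter fun p => p.1 < c).card := by
  unfold countBelow
  congr 1
  apply Finset.filter_true_of_mem
  intro q hq
  obtain ⟨hqQ, hqc⟩ := Finset.mem_filter.1 hq
  apply Finset.card_lt_card
  rw [Finset.ssubset_iff_of_subset]
  · exact ⟨q, hq, by simp⟩
  · intro p hp
    obtain ⟨hpQ, hpq⟩ := Finset.mem_filter.1 hp
    refine Finset.mem_filter.2 ⟨hpQ, lt_of_le_of_lt ?_ hqc⟩
    by_contra! hlt
    have a1 := intercept_lt_iff (θ := θ) hlt
    have a2 := intercept_lt_iff' (θ := θ) hlt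
    have := hθ _ (hT q hqQ p hpQ hlt)
    grind

theorem countBelow_eq_zero_of_slopes_lt
    (hT : ∀ p ∈ Q, ∀ q ∈ Q, p.1 < q.1 → slopeOf p q ∈ T) (hθ : ∀ σ ∈ T, σ < θ) {c : ℝ} {h : ℕ}
    (hh : h ≤ (Q.filter fun p => c ≤ p.1).card) :
    countBelow (Q.filter fun p => p.1 < c) (lexRank Q (intercept θ) Prod.fst) h = 0 := by
  unfold countBelow
  rw [Finset.card_eq_zero]
  apply Finset.filter_false_of_mem
  intro q hq
  obtain ⟨hqQ, hqc⟩ := Finset.mem_filter.1 hq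
  refine (hh.trans (Finset.card_le_card ?_)).not_gt
  intro p hp
  obtain ⟨hpQ, hpc⟩ := Finset.mem_filter.1 hp
  have hlt : q.1 < p.1 := hqc.trans_le hpc
  exact Finset.mem_filter.2
    ⟨hpQ, Or.inl ((intercept_lt_iff' hlt).2 (hθ _ (hT q hqQ p hpQ hlt)))⟩

/-- Potential bound along the rotation: up to direction `θ`, the potential has grown by at most one
for each slope passed, less twice the number of points that have crossed the cut. -/
theorem cutPotentialLE_intercept
    (hT : ∀ p ∈ Q, ∀ q ∈ Q, p.1 < q.1 → slopeOf p q ∈ T) {c : ℝ} {h : ℕ}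
    (hh : (Q.filter fun p => p.1 < c).card = h) (hN : h < Q.card)
    (hn : (Q.image Prod.fst).card < h) (m : ℕ) :
    ∀ θ : ℝ, (T.filter fun σ => σ < θ).card = m →
      CutPotentialLE Q (lexRank Q (intercept θ) Prod.fst) Prod.fst h
        ((Q.image Prod.fst).card + m - 2 * ((h : ℤ) -
          countBelow (Q.filter fun p => p.1 < c) (lexRank Q (intercept θ) Prod.fst) h)) := by
  induction m with
  | zero =>
    intro θ hθ
    have hle : ∀ σ ∈ T, θ ≤ σ := by
      intro σ hσ
      by_contra! hlt
      exact Finset.notMem_empty σ (Finset.card_eq_zero.1 hθ ▸ Finset.mem_filter.2 ⟨hσ, hlt⟩)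
    have hcount := countBelow_eq_card_of_le_slopes hT hle c
    rw [hh] at hcount
    rw [hcount]
    refine Or.inl ⟨by simp, fun r hr => ?_⟩
    have := hr.le_card_image (separatesPoints_intercept Q θ) hN hn
    simp
    exact this
  | succ m ih =>
    intro θ hθ
    have hne : (T.filter fun σ => σ < θ).Nonempty := by
      rw [← Finset.card_pos]; omega
    set θ' := (T.filter fun σ => σ < θ).max' hne with hθ'
    have hmem : θ' ∈ T.filter fun σ => σ < θ := Finset.max'_mem _ _
    obtain ⟨hθT, hlt⟩ := Finset.mem_filter.1 hmem
    have hgap : ∀ σ ∈ T, σ < θ → σ ≤ θ' := fun σ h1 h2 =>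
      Finset.le_max' _ _ (Finset.mem_filter.2 ⟨h1, h2⟩)
    have hcard : (T.filter fun σ => σ < θ').card = m := by
      have : (T.filter fun σ => σ < θ') = (T.filter fun σ => σ < θ).erase θ' := by
        ext σ
        simp only [Finset.mem_filter, Finset.mem_erase]
        grind
      rw [this, Finset.card_erase_of_mem hmem, hθ]
      rfl
    have hstep := (ih θ' hcard).step (separatesPoints_intercept Q θ') (by omega) hN
      (Finset.filter_subset (fun p : ℝ × ℝ => p.1 < c) Q)
    have heq : ∀ q ∈ Q, lexRank Q (intercept θ') (-Prod.fst) q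
        = lexRank Q (intercept θ) Prod.fst q := fun q hq => lexRank_intercept_eq hT hlt hgap hq
    have hcount : countBelow (Q.filter fun p => p.1 < c) (lexRank Q (intercept θ') (-Prod.fst)) h
        = countBelow (Q.filter fun p => p.1 < c) (lexRank Q (intercept θ) Prod.fst) h := by
      unfold countBelow
      congr 1
      apply Finset.filter_congr
      intro q hq
      rw [heq q (Finset.mem_filter.1 hq).1]
    rw [hcount, CutPotentialLE.congr heq] at hstep
    exact hstep.mono (by push_cast; linarith)

/-- A weak form of Ungar's theorem on directions. If a vertical line has `h` points of `Q` strictly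
to its left and at least `h` points not to its left, and the points of `Q` lie on fewer than `h`
vertical lines, then the number of slopes determined by `Q` is at least `2 * h`, up to an error of
twice the number of these vertical lines. -/
theorem two_mul_card_le_card_slopes
    (hT : ∀ p ∈ Q, ∀ q ∈ Q, p.1 < q.1 → slopeOf p q ∈ T) {c : ℝ} {h : ℕ}
    (hh : (Q.filter fun p => p.1 < c).card = h) (hh' : h ≤ (Q.filter fun p => c ≤ p.1).card)
    (hn : (Q.image Prod.fst).card < h) :
    2 * h ≤ T.card + 2 * (Q.image Prod.fst).card := by
  have hQ : h + (Q.filter fun p => c ≤ p.1).card = Q.card := by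
    rw [← hh, ← Finset.card_filter_add_card_filter_not (s := Q) (fun p => p.1 < c)]
    simp
  have hN : h < Q.card := by omega
  obtain ⟨M, hM⟩ := T.bddAbove
  have hθ : ∀ σ ∈ T, σ < M + 1 := fun σ hσ => (hM hσ).trans_lt (lt_add_one M)
  have hpot := cutPotentialLE_intercept hT hh hN hn T.card (M + 1)
    (by rw [Finset.filter_true_of_mem hθ])
  rw [countBelow_eq_zero_of_slopes_lt hT hθ hh'] at hpot
  have himg : (Q.image (-Prod.fst)).card = (Q.image Prod.fst).card := by
    have : Q.image (-Prod.fst) = (Q.image Prod.fst).image Neg.neg := by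
      rw [Finset.image_image]; rfl
    rw [this, Finset.card_image_of_injective _ neg_injective]
  -- The potential is at least minus the number of vertical lines.
  rcases hpot with ⟨h0, -⟩ | ⟨k, hk, hkE⟩
  · push_cast at h0
    omega
  · have := hk.le_card_image (separatesPoints_intercept Q _) hN (by rw [himg]; exact hn)
    rw [himg] at this
    push_cast at hkE
    omega

end Slopes

/-! ### Bisectors of a grid and the vertical axis -/

section Bisectors

/-- The points `(b, a ^ 2 + b ^ 2)` with `a, b ∈ A`: each grid point `(a, b)` is recorded by its
height and its squared norm. The columns are vertical translates of the set of squares of elements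
of `A`. -/
noncomputable def liftedGrid (A : Finset ℝ) : Finset (ℝ × ℝ) :=
  (A ×ˢ A.image (· ^ 2)).image fun z => (z.1, z.2 + z.1 ^ 2)

theorem card_filter_liftedGrid (A : Finset ℝ) (P : ℝ → Prop) [DecidablePred P] :
    ((liftedGrid A).filter fun p => P p.1).card
      = (A.filter P).card * (A.image (· ^ 2)).card := by
  have hinj : Function.Injective fun z : ℝ × ℝ => (z.1, z.2 + z.1 ^ 2) := by
    rintro ⟨a, b⟩ ⟨c, d⟩ h
    simp only [Prod.mk.injEq] at h
    obtain ⟨rfl, h⟩ := h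
    simpa using h
  unfold liftedGrid
  rw [Finset.filter_image, Finset.card_image_of_injective _ hinj]
  rw [← Finset.card_product, ← Finset.filter_product_left]

theorem card_le_two_mul_card_image_sq (A : Finset ℝ) :
    A.card ≤ 2 * (A.image (· ^ 2)).card := by
  apply Finset.card_le_mul_card_image
  intro a ha
  obtain ⟨y, -, rfl⟩ := Finset.mem_image.1 ha
  refine (Finset.card_le_card (t := {y, -y}) ?_).trans Finset.card_le_two
  intro z hz
  have := (Finset.mem_filter.1 hz).2
  simpa using sq_eq_sq_iff_eq_or_eq_neg.1 this

theorem mem_perpBisector_iff_sq {p q z : Plane} :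
    z ∈ AffineSubspace.perpBisector p q ↔
      (z 0 - p 0) ^ 2 + (z 1 - p 1) ^ 2 = (z 0 - q 0) ^ 2 + (z 1 - q 1) ^ 2 := by
  rw [AffineSubspace.mem_perpBisector_iff_dist_eq, EuclideanSpace.dist_eq, EuclideanSpace.dist_eq,
    Real.sqrt_inj (by positivity) (by positivity)]
  simp [Fin.sum_univ_two, Real.dist_eq, sq_abs]

theorem finite_hittingPoints (A : Finset ℝ) :
    (hittingPoints (bisectors (gridPoints A)) yAxis).Finite := by
  have hfin := ((A ×ˢ A) ×ˢ (A ×ˢ A)).finite_toSet.image fun w : (ℝ × ℝ) × (ℝ × ℝ) =>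
    (!₂[(0 : ℝ), slopeOf (w.1.2, w.1.1 ^ 2 + w.1.2 ^ 2) (w.2.2, w.2.1 ^ 2 + w.2.2 ^ 2) / 2] : Plane)
  refine hfin.subset ?_
  rintro z ⟨hz, L, ⟨p, hp, q, hq, hpq, rfl⟩, hL, hzL⟩
  have hz0 : z 0 = 0 := hz
  have hz1 := mem_perpBisector_iff_sq.1 hzL
  refine ⟨((p 0, p 1), (q 0, q 1)), ?_, ?_⟩
  · simp [hp.1, hp.2, hq.1, hq.2]
  · have hne : q 1 - p 1 ≠ 0 := by
      intro h0
      have h1 : q 1 = p 1 := by linarith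
      -- A bisector of two points at the same height that meets the axis is the axis.
      rw [hz0, h1] at hz1
      have hsq : p 0 ^ 2 = q 0 ^ 2 := by linarith
      have hx : p 0 ≠ q 0 := by
        intro h
        apply hpq
        ext i
        fin_cases i
        · exact h
        · exact h1.symm
      have hneg : p 0 = -q 0 := (sq_eq_sq_iff_eq_or_eq_neg.1 hsq).resolve_left hx
      have hq0 : q 0 ≠ 0 := by
        intro h
        apply hx
        rw [hneg, h, neg_zero]
      apply hL
      ext w
      rw [SetLike.mem_coe, mem_perpBisector_iff_sq, h1, hneg]
      change _ ↔ w 0 = 0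
      constructor
      · intro hw
        have : w 0 * q 0 = 0 := by linarith
        exact (mul_eq_zero.1 this).resolve_right hq0
      · intro hw
        rw [hw]
        ring
    ext i
    fin_cases i
    · simp [hz0]
    · simp only [slopeOf]
      rw [hz0] at hz1
      simp
      field_simp
      linarith

/-- Every slope determined by `liftedGrid A` is twice the height of a hitting point: `(0, t)` is
equidistant from `(a, b)` and `(c, d)` precisely if
`c ^ 2 + d ^ 2 - (a ^ 2 + b ^ 2) = 2 * t * (d - b)`. -/
theorem slope_half_mem_hittingPoints {A : Finset ℝ} {p q : ℝ × ℝ} (hp : p ∈ liftedGrid A)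
    (hq : q ∈ liftedGrid A) (hpq : p.1 < q.1) :
    (!₂[(0 : ℝ), slopeOf p q / 2] : Plane) ∈
      hittingPoints (bisectors (gridPoints A)) yAxis := by
  simp only [liftedGrid, Finset.mem_image, Finset.mem_product, Prod.exists] at hp hq
  obtain ⟨b, s, ⟨hb, a, ha, rfl⟩, rfl⟩ := hp
  obtain ⟨d, s, ⟨hd, c, hc, rfl⟩, rfl⟩ := hq
  simp only at hpq
  have hdb : d - b ≠ 0 := (sub_pos.2 hpq).ne'
  have hmem : ∀ t : ℝ, (!₂[(0 : ℝ), t] : Plane) ∈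
      AffineSubspace.perpBisector (!₂[a, b] : Plane) !₂[c, d] ↔
        2 * t * (d - b) = c ^ 2 + d ^ 2 - (a ^ 2 + b ^ 2) := by
    intro t
    rw [mem_perpBisector_iff_sq]
    simp
    constructor <;> intro h <;> linarith
  refine ⟨by simp [yAxis], AffineSubspace.perpBisector (!₂[a, b] : Plane) !₂[c, d],
    ⟨!₂[a, b], by simp [gridPoints, ha, hb], !₂[c, d], by simp [gridPoints, hc, hd], ?_, rfl⟩,
    ?_, ?_⟩
  · intro h
    have := congrArg (fun z : Plane => z 1) h
    simp at this
    exact hpq.ne this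
  · intro h
    have h0 : ∀ t : ℝ, (!₂[(0 : ℝ), t] : Plane) ∈
        AffineSubspace.perpBisector (!₂[a, b] : Plane) !₂[c, d] := by
      intro t
      rw [← SetLike.mem_coe, h]
      simp [yAxis]
    have e0 := (hmem 0).1 (h0 0)
    have e1 := (hmem 1).1 (h0 1)
    apply hdb
    linarith
  · rw [hmem]
    simp only [slopeOf]
    field_simp

theorem exists_card_filter_lt_eq (A : Finset ℝ) {k : ℕ} (hk : k < A.card) :
    ∃ c, (A.filter fun a => a < c).card = k := by
  obtain ⟨c, -, hc⟩ := exists_lexRank_eq (Q := A) (f := id) (x := 0)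
    (fun p _ q _ hpq _ => hpq) hk
  exact ⟨c, by simpa [lexRank] using hc⟩

theorem card_slopes_liftedGrid {A : Finset ℝ} (hA : 8 ≤ A.card) {T : Finset ℝ}
    (hT : ∀ p ∈ liftedGrid A, ∀ q ∈ liftedGrid A, p.1 < q.1 → slopeOf p q ∈ T) :
    (A.card : ℝ) ^ 2 / 64 ≤ T.card := by
  obtain ⟨c, hc⟩ := exists_card_filter_lt_eq A (k := A.card / 2) (by omega)
  have hsum := Finset.card_filter_add_card_filter_not (s := A) (fun a => a < c)
  simp only [not_lt] at hsum
  have hm := card_le_two_mul_card_image_sq A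
  have hleft := card_filter_liftedGrid A fun a => a < c
  have hright := card_filter_liftedGrid A fun a => c ≤ a
  have hfst : ((liftedGrid A).image Prod.fst).card ≤ A.card := by
    apply Finset.card_le_card
    intro b hb
    simp only [liftedGrid, Finset.mem_image, Finset.mem_product, Prod.exists] at hb
    grind
  set m := (A.image (· ^ 2)).card
  have hh : A.card < A.card / 2 * m := by
    have h4 : 4 ≤ m := by omega
    have := Nat.mul_le_mul_left (A.card / 2) h4
    omega
  have hmain := two_mul_card_le_card_slopes hT (c := c) (h := A.card / 2 * m)
    (by rw [hleft, hc]) (by rw [hright]; exact Nat.mul_le_mul_right _ (by omega)) (by omega)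
  have h1 : 2 * (A.card / 2 * m) ≤ T.card + 2 * A.card := by omega
  have h2 : (A.card - 1) * m ≤ 2 * (A.card / 2 * m) := by
    rw [← mul_assoc]
    exact Nat.mul_le_mul_right _ (by omega)
  have h3 : ((A.card : ℝ) - 1) * m ≤ T.card + 2 * A.card := by
    have : (((A.card - 1 : ℕ) : ℝ)) * m ≤ T.card + 2 * A.card := by exact_mod_cast h2.trans h1
    rwa [Nat.cast_sub (by omega), Nat.cast_one] at this
  have h8 : (8 : ℝ) ≤ A.card := by exact_mod_cast hA
  have hm' : (A.card : ℝ) ≤ 2 * m := by exact_mod_cast hm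
  have h5 : ((A.card : ℝ) - 1) * A.card ≤ (A.card - 1) * (2 * m) :=
    mul_le_mul_of_nonneg_left hm' (by linarith)
  nlinarith

end Bisectors

theorem mainTheorem3 :
    ∃ c : ℝ, 0 < c ∧ ∀ A : Finset ℝ, 2 ≤ A.card →
      c * (A.card : ℝ) ^ 2 ≤ ((hittingPoints (bisectors (gridPoints A)) yAxis).ncard : ℝ) := by
  refine ⟨1 / 64, by norm_num, fun A hA => ?_⟩
  have hfin := finite_hittingPoints A
  set T : Finset ℝ := hfin.toFinset.image fun z => 2 * z 1 with hTdef
  have hTcard : T.card ≤ (hittingPoints (bisectors (gridPoints A)) yAxis).ncard := by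
    rw [Set.ncard_eq_toFinset_card _ hfin]
    exact Finset.card_image_le
  have hT : ∀ p ∈ liftedGrid A, ∀ q ∈ liftedGrid A, p.1 < q.1 →
      slopeOf p q ∈ T := by
    intro p hp q hq hpq
    refine Finset.mem_image.2 ⟨_, hfin.mem_toFinset.2 (slope_half_mem_hittingPoints hp hq hpq), ?_⟩
    simp
    ring
  have hcast : (T.card : ℝ) ≤ (hittingPoints (bisectors (gridPoints A)) yAxis).ncard := by
    exact_mod_cast hTcard
  refine le_trans ?_ hcast
  rcases le_or_gt 8 A.card with h8 | h8
  · linarith [card_slopes_liftedGrid h8 hT]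
  · -- For fewer than eight elements a single point is enough.
    obtain ⟨a, ha, b, hb, hab⟩ := Finset.one_lt_card.1 hA
    wlog hlt : a < b generalizing a b
    · exact this b hb a ha hab.symm (lt_of_le_of_ne (not_lt.1 hlt) hab.symm)
    have hmem : ∀ y ∈ A, (y, a ^ 2 + y ^ 2) ∈ liftedGrid A := fun y hy =>
      Finset.mem_image.2 ⟨(y, a ^ 2),
        Finset.mem_product.2 ⟨hy, Finset.mem_image_of_mem _ ha⟩, rfl⟩
    have hpos : 1 ≤ T.card := Finset.card_pos.2 ⟨_, hT _ (hmem a ha) _ (hmem b hb) hlt⟩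
    have h1 : (1 : ℝ) ≤ T.card := by exact_mod_cast hpos
    have h2 : (A.card : ℝ) ≤ 8 := by exact_mod_cast h8.le
    have h3 : (0 : ℝ) ≤ A.card := by positivity
    nlinarith
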